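/- Let $E_{ij}$ be the $3\times 3$ matrix units and let $G=sl(2/1)$ be the complex Lie superalgebra of $3\times3$ matrices $x$ with supertrace $x_{11}+x_{22}-x_{33}=0$ (indices $1,2$ even, index $3$ odd), with the supercommutator as bracket. Write $e_1=E_{12}$, $f_1=E_{21}$, $h_1=E_{11}-E_{22}$, $h_2=E_{22}+E_{33}$, $G_{\bar 0}=\langle e_1,f_1,h_1,h_2\rangle$ and $G_{+1}=\langle E_{13},E_{23}\rangle$; the element $h_1+2h_2$ is central in $G_{\bar0}$, and $sl(2)=\langle e_1,h_1,f_1\rangle\subset G_{\bar 0}$. For $a,b\in\mathbb C$ and $m\ge 1$ let $U(a,b,m)$ be the $sl(2)$-module with basis $x^{(i)}_j$ ($j\in\mathbb Z$, $1\le i\le m$) and action $$e_1x^{(i)}_j=-(j+a)(j+b)\,x^{(i)}_{j+1}+x^{(i-1)}_{j+1},\qquad f_1x^{(i)}_j=x^{(i)}_{j-1},\qquad h_1x^{(i)}_j=(2j+a+b-1)\,x^{(i)}_j,$$ where $x^{(0)}_j=0$. For a $G_{\bar0}$-module $W$, let $G_{+1}$ act on $W$ by zero and let $\overline W=U(G)\otimes_{U(G_{\bar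 0}\oplus G_{+1})}W$ be the induced $G$-module, in which $w\in W$ is identified with $1\otimes w$. Call $\overline W$ atypical if it has a nonzero $G$-submodule $W'$ with $W'\cap W=0$. Lemma 3.2. Let $a,b,c\in\mathbb C$, $m\ge1$, and let $W$ be a nonzero $G_{\bar 0}$-module which, as an $sl(2)$-module, is isomorphic to a subquotient of $U(a,b,m)$, and on which $h_1+2h_2$ acts as the scalar $c$. Then $\overline W$ is atypical if and only if $a-b+c+1=0$ or $a-b-c-1=0$. -/

import Mathlib

open scoped TensorProduct

attribute [local instance 100] LieRing.ofAssociativeRing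

noncomputable section

namespace SL21

/-! ### The superalgebra `gl(2/1)` and its Lie sub-superalgebras -/

/-- `3 × 3` complex matrices; the indices `0, 1` are even and the index `2` is odd. -/
abbrev Mat : Type := Matrix (Fin 3) (Fin 3) ℂ

/-- The even (block diagonal) part of a matrix. -/
def evenPart : Mat →ₗ[ℂ] Mat where
  toFun x := Matrix.of fun i j => if (i = 2 ↔ j = 2) then x i j else 0
  map_add' x y := by
    ext i j
    by_cases h : (i = 2 ↔ j = 2) <;> simp [h]
  map_smul' t x := by
    ext i j
    by_cases h : (i = 2 ↔ j = 2) <;> simp [h]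

/-- The odd (block off-diagonal) part of a matrix. -/
def oddPart : Mat →ₗ[ℂ] Mat := LinearMap.id - evenPart

/-- The supertrace. -/
def supertrace : Mat →ₗ[ℂ] ℂ where
  toFun x := x 0 0 + x 1 1 - x 2 2
  map_add' x y := by simp only [Matrix.add_apply]; ring
  map_smul' t x := by simp only [Matrix.smul_apply, smul_eq_mul, RingHom.id_apply]; ring

/-- The supercommutator, i.e. the bilinear extension of
`[x, y] = x y - (-1)^(|x||y|) y x` from homogeneous `x`, `y`. -/
def superBracket (x y : Mat) : Mat :=
  x * y - y * x + (2 : ℂ) • (oddPart y * oddPart x)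

/-- Lie sub-superalgebras of `gl(2/1)`: graded subspaces closed under the supercommutator. -/
structure LieSubSuperalgebra extends Submodule ℂ Mat where
  evenPart_mem : ∀ x ∈ toSubmodule, evenPart x ∈ toSubmodule
  bracket_mem : ∀ x ∈ toSubmodule, ∀ y ∈ toSubmodule, superBracket x y ∈ toSubmodule

/-- The basis elements of `sl(2/1)`, with `E i j` the matrix units. -/
def e₁ : Mat := Matrix.single 0 1 1
def e₂ : Mat := Matrix.single 1 2 1
def e₃ : Mat := Matrix.single 0 2 1
def f₁ : Mat := Matrix.single 1 0 1
def f₂ : Mat := Matrix.single 2 1 1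
def f₃ : Mat := Matrix.single 2 0 1
def h₁ : Mat := Matrix.single 0 0 1 - Matrix.single 1 1 1
def h₂ : Mat := Matrix.single 1 1 1 + Matrix.single 2 2 1

/-- The Lie superalgebra `G = sl(2/1)` of matrices of supertrace `0`. -/
def G : LieSubSuperalgebra where
  toSubmodule := LinearMap.ker supertrace
  evenPart_mem x hx := by
    simpa [supertrace, evenPart] using hx
  bracket_mem x hx y hy := by
    simp [supertrace, superBracket, oddPart, evenPart, Matrix.mul_apply, Fin.sum_univ_three]
    ring

/-- The sub-superalgebra `G₀ ⊕ G₊₁` of `G`, where `G₊₁ = ⟨e₂, e₃⟩`: the matrices in `G` whose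
`f₂`- and `f₃`-entries vanish. -/
def P : LieSubSuperalgebra where
  toSubmodule :=
    { carrier := {x | supertrace x = 0 ∧ x 2 0 = 0 ∧ x 2 1 = 0}
      zero_mem' := by simp
      add_mem' := by
        rintro x y ⟨hx, hx0, hx1⟩ ⟨hy, hy0, hy1⟩
        simp [hx, hx0, hx1, hy, hy0, hy1]
      smul_mem' := by
        rintro t x ⟨hx, hx0, hx1⟩
        simp [hx, hx0, hx1] }
  evenPart_mem := by
    rintro x ⟨hx, hx0, hx1⟩
    refine ⟨?_, ?_, ?_⟩
    · simpa [supertrace, evenPart] using hx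
    · simp [evenPart]
    · simp [evenPart]
  bracket_mem := by
    rintro x ⟨hx, hx0, hx1⟩ y ⟨hy, hy0, hy1⟩
    refine ⟨?_, ?_, ?_⟩
    · simp [supertrace, superBracket, oddPart, evenPart, Matrix.mul_apply, Fin.sum_univ_three]
      ring
    · simp [superBracket, oddPart, evenPart, Matrix.mul_apply, Fin.sum_univ_three, hx0, hx1,
        hy0, hy1]
    · simp [superBracket, oddPart, evenPart, Matrix.mul_apply, Fin.sum_univ_three, hx0, hx1,
        hy0, hy1]

theorem P_le_G : P.toSubmodule ≤ G.toSubmodule := fun _ hx => hx.1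

/-- The even part `G₀ = ⟨e₁, f₁, h₁, h₂⟩` of `G`, an ordinary Lie algebra. -/
def G₀ : LieSubalgebra ℂ Mat where
  carrier := {x | supertrace x = 0 ∧ oddPart x = 0}
  zero_mem' := by simp
  add_mem' := by
    rintro x y ⟨hx, hx'⟩ ⟨hy, hy'⟩
    simp [hx, hx', hy, hy']
  smul_mem' := by
    rintro t x ⟨hx, hx'⟩
    simp [hx, hx']
  lie_mem' := by
    rintro x y ⟨hx, hx'⟩ ⟨hy, hy'⟩
    have key : ∀ z : Mat, oddPart z = 0 ↔ z 0 2 = 0 ∧ z 1 2 = 0 ∧ z 2 0 = 0 ∧ z 2 1 = 0 := by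
      intro z
      rw [← Matrix.ext_iff]
      simp [oddPart, evenPart, Fin.forall_fin_succ]
    obtain ⟨x1, x2, x3, x4⟩ := (key x).1 hx'
    obtain ⟨y1, y2, y3, y4⟩ := (key y).1 hy'
    refine ⟨?_, (key _).2 ?_⟩
    · simp [supertrace, Ring.lie_def, Matrix.mul_apply, Fin.sum_univ_three, x1, x2, x3, x4,
        y1, y2, y3, y4]
      ring
    · simp [Ring.lie_def, Matrix.mul_apply, Fin.sum_univ_three, x1, x2, x3, x4, y1, y2, y3, y4]

/-- The central element `h₁ + 2 h₂ = diag(1, 1, 2)` of `G₀`. -/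
def cc : G₀ :=
  ⟨h₁ + (2 : ℂ) • h₂, by
    refine ⟨?_, ?_⟩
    · simp [supertrace, h₁, h₂]
    · ext i j
      fin_cases i <;> fin_cases j <;> simp [oddPart, evenPart, h₁, h₂, Matrix.single_apply]⟩

/-- The subalgebra `⟨e₁, h₁, f₁⟩ ≅ sl(2)` of `G₀`: the matrices in `G₀` supported on the upper
left `2 × 2` block. -/
def sl2 : LieSubalgebra ℂ G₀ where
  carrier := {x | (x : Mat) 2 2 = 0}
  zero_mem' := by simp
  add_mem' := by
    intro x y hx hy
    change (x : Mat) 2 2 = 0 at hx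
    change (y : Mat) 2 2 = 0 at hy
    simp [hx, hy]
  smul_mem' := by
    intro t x hx
    change (x : Mat) 2 2 = 0 at hx
    simp [hx]
  lie_mem' := by
    rintro ⟨x, hx, hx'⟩ ⟨y, hy, hy'⟩ _ _
    have h (z : Mat) (hz : oddPart z = 0) : z 2 0 = 0 ∧ z 2 1 = 0 := by
      constructor
      · simpa [oddPart, evenPart] using congrFun (congrFun hz 2) 0
      · simpa [oddPart, evenPart] using congrFun (congrFun hz 2) 1
    obtain ⟨x1, x2⟩ := h x hx'
    obtain ⟨y1, y2⟩ := h y hy'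
    simp [Ring.lie_def, Matrix.mul_apply, Fin.sum_univ_three, x1, x2, y1, y2]
    ring

/-! ### The `sl(2)`-modules `U(a,b,m)` -/

/-- The space with basis `x^{(i)}_j`, `j ∈ ℤ`, `1 ≤ i ≤ m`. -/
def UMod (_a _b : ℂ) (m : ℕ) : Type := (ℤ × Fin m) →₀ ℂ

namespace UMod

variable (a b : ℂ) (m : ℕ)

instance : AddCommGroup (UMod a b m) := inferInstanceAs (AddCommGroup ((ℤ × Fin m) →₀ ℂ))
instance : Module ℂ (UMod a b m) := inferInstanceAs (Module ℂ ((ℤ × Fin m) →₀ ℂ))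

/-- The basis of `U(a,b,m)`, indexed by the pairs `(j, i - 1)`. -/
def basis : Module.Basis (ℤ × Fin m) ℂ (UMod a b m) :=
  (Finsupp.basisSingleOne : Module.Basis (ℤ × Fin m) ℂ ((ℤ × Fin m) →₀ ℂ))

/-- `x a b m i j` is `x^{(i)}_j` for `1 ≤ i ≤ m`, and `0` otherwise. -/
def x (i : ℕ) (j : ℤ) : UMod a b m :=
  if h : 1 ≤ i ∧ i ≤ m then basis a b m (j, ⟨i - 1, by omega⟩) else 0

/-- The linear endomorphism sending `x^{(i)}_j` to `g i j`, for `1 ≤ i ≤ m`. -/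
def ofBasis (g : ℕ → ℤ → UMod a b m) : Module.End ℂ (UMod a b m) :=
  (basis a b m).constr ℂ fun p => g (p.2 + 1) p.1

/-- `e₁ x^{(i)}_j = -(j+a)(j+b) x^{(i)}_{j+1} + x^{(i-1)}_{j+1}` -/
def opE : Module.End ℂ (UMod a b m) :=
  ofBasis a b m fun i j => (-((j + a) * (j + b))) • x a b m i (j + 1) + x a b m (i - 1) (j + 1)

/-- `f₁ x^{(i)}_j = x^{(i)}_{j-1}` -/
def opF : Module.End ℂ (UMod a b m) :=
  ofBasis a b m fun i j => x a b m i (j - 1)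

/-- `h₁ x^{(i)}_j = (2j+a+b-1) x^{(i)}_j` -/
def opH : Module.End ℂ (UMod a b m) :=
  ofBasis a b m fun i j => (2 * j + a + b - 1) • x a b m i j

variable {a b m}

theorem ofBasis_x (g : ℕ → ℤ → UMod a b m) (i : ℕ) (j : ℤ) :
    ofBasis a b m g (x a b m i j) = if 1 ≤ i ∧ i ≤ m then g i j else 0 := by
  unfold x
  split_ifs with h
  · simp [ofBasis, Nat.sub_add_cancel h.1]
  · exact map_zero _

theorem x_eq_zero {i : ℕ} (h : ¬(1 ≤ i ∧ i ≤ m)) (j : ℤ) : x a b m i j = 0 := dif_neg h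

theorem end_ext {S T : Module.End ℂ (UMod a b m)}
    (h : ∀ i j, 1 ≤ i → i ≤ m → S (x a b m i j) = T (x a b m i j)) : S = T := by
  refine (basis a b m).ext fun p => ?_
  have hx : x a b m (p.2 + 1) p.1 = basis a b m p := by
    unfold x
    rw [dif_pos ⟨by omega, by omega⟩]
    rfl
  rw [← hx]
  exact h _ _ (by omega) (by omega)

theorem opE_x (i : ℕ) (j : ℤ) : opE a b m (x a b m i j) =
    if i ≤ m then (-((j + a) * (j + b))) • x a b m i (j + 1) + x a b m (i - 1) (j + 1) else 0 := by
  rw [opE, ofBasis_x]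
  rcases Nat.eq_zero_or_pos i with rfl | hi
  · simp [x_eq_zero]
  · have : 1 ≤ i := hi
    simp [this]

theorem opF_x (i : ℕ) (j : ℤ) : opF a b m (x a b m i j) = x a b m i (j - 1) := by
  rw [opF, ofBasis_x]
  split_ifs with h
  · rfl
  · rw [x_eq_zero h]

theorem opH_x (i : ℕ) (j : ℤ) :
    opH a b m (x a b m i j) = (2 * j + a + b - 1) • x a b m i j := by
  rw [opH, ofBasis_x]
  split_ifs with h
  · rfl
  · rw [x_eq_zero h, smul_zero]

theorem lie_E_F : ⁅opE a b m, opF a b m⁆ = opH a b m := by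
  refine end_ext fun i j _ hi => ?_
  have hi' : i - 1 ≤ m := by omega
  simp only [Ring.lie_def, LinearMap.sub_apply, Module.End.mul_apply, opE_x, opF_x, opH_x, hi,
    if_true, map_add, map_smul, sub_add_cancel, add_sub_cancel_right]
  push_cast
  module

theorem lie_H_E : ⁅opH a b m, opE a b m⁆ = (2 : ℂ) • opE a b m := by
  refine end_ext fun i j _ hi => ?_
  simp only [Ring.lie_def, LinearMap.sub_apply, Module.End.mul_apply, opE_x, opH_x, hi,
    if_true, map_add, map_smul, LinearMap.smul_apply]
  push_cast
  module

theorem lie_H_F : ⁅opH a b m, opF a b m⁆ = (-2 : ℂ) • opF a b m := by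
  refine end_ext fun i j _ hi => ?_
  simp only [Ring.lie_def, LinearMap.sub_apply, Module.End.mul_apply, opF_x, opH_x,
    map_smul, LinearMap.smul_apply]
  push_cast
  module

variable (a b m)

/-- The representation of `sl(2) = ⟨e₁, f₁, h₁⟩` on `U(a,b,m)`: the element
`s e₁ + t f₁ + u h₁` acts as `s E + t F + u H`. -/
def rep : sl2 →ₗ⁅ℂ⁆ Module.End ℂ (UMod a b m) where
  toFun y := (y : Mat) 0 1 • opE a b m + (y : Mat) 1 0 • opF a b m + (y : Mat) 0 0 • opH a b m
  map_add' y z := by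
    have h : ∀ i j, ((y + z : sl2) : Mat) i j = (y : Mat) i j + (z : Mat) i j := fun _ _ => rfl
    simp only [h]
    module
  map_smul' t y := by
    have h : ∀ i j, ((t • y : sl2) : Mat) i j = t * (y : Mat) i j := fun _ _ => rfl
    simp only [h, RingHom.id_apply]
    module
  map_lie' := by
    rintro ⟨⟨y, hy, hy'⟩, hy''⟩ ⟨⟨z, hz, hz'⟩, hz''⟩
    have h (w : Mat) (hw : supertrace w = 0) (hw' : oddPart w = 0) (hw'' : w 2 2 = 0) :
        w 0 2 = 0 ∧ w 1 2 = 0 ∧ w 1 1 = - w 0 0 := by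
      refine ⟨?_, ?_, ?_⟩
      · simpa [oddPart, evenPart] using congrFun (congrFun hw' 0) 2
      · simpa [oddPart, evenPart] using congrFun (congrFun hw' 1) 2
      · simp only [supertrace, LinearMap.coe_mk, AddHom.coe_mk, hw''] at hw
        linear_combination hw
    obtain ⟨y1, y2, y3⟩ := h y hy hy' hy''
    obtain ⟨z1, z2, z3⟩ := h z hz hz' hz''
    have hFE : ⁅opF a b m, opE a b m⁆ = - opH a b m := by rw [← lie_skew, lie_E_F]
    have hEH : ⁅opE a b m, opH a b m⁆ = -((2 : ℂ) • opE a b m) := by rw [← lie_skew, lie_H_E]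
    have hFH : ⁅opF a b m, opH a b m⁆ = -((-2 : ℂ) • opF a b m) := by rw [← lie_skew, lie_H_F]
    simp only [lie_add, add_lie, smul_lie, lie_smul, lie_self, lie_E_F, lie_H_E, lie_H_F, hFE,
      hEH, hFH]
    simp only [LieSubalgebra.coe_bracket, Ring.lie_def, Matrix.sub_apply, Matrix.mul_apply,
      Fin.sum_univ_three, y1, y2, y3, z1, z2, z3]
    module

instance : LieRingModule sl2 (UMod a b m) := LieRingModule.compLieHom _ (rep a b m)
instance : LieModule ℂ sl2 (UMod a b m) := LieModule.compLieHom _ (rep a b m)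

end UMod

/-- `W` is isomorphic to a subquotient of `U` (as modules of the Lie algebra `L`). -/
def IsSubquotient (L : Type*) [LieRing L] [LieAlgebra ℂ L]
    (W : Type*) [AddCommGroup W] [Module ℂ W] [LieRingModule L W]
    (U : Type*) [AddCommGroup U] [Module ℂ U] [LieRingModule L U] [LieModule ℂ L U] : Prop :=
  ∃ (B : LieSubmodule ℂ L U) (A : LieSubmodule ℂ L B), Nonempty ((B ⧸ A) ≃ₗ⁅ℂ,L⁆ W)

/-! ### Enveloping superalgebras -/

/-- The defining relations of the enveloping superalgebra:
`x y - (-1)^(|x||y|) y x = [x, y]` for homogeneous `x`, `y`. -/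
inductive UEnv.Rel (L : LieSubSuperalgebra) :
    TensorAlgebra ℂ L.toSubmodule → TensorAlgebra ℂ L.toSubmodule → Prop
  | comm (x y : L.toSubmodule) (h : oddPart x = 0 ∨ oddPart y = 0) :
      UEnv.Rel L
        (TensorAlgebra.ι ℂ x * TensorAlgebra.ι ℂ y - TensorAlgebra.ι ℂ y * TensorAlgebra.ι ℂ x)
        (TensorAlgebra.ι ℂ (⟨superBracket x y, L.bracket_mem x x.2 y y.2⟩ : L.toSubmodule))
  | anticomm (x y : L.toSubmodule) (hx : evenPart x = 0) (hy : evenPart y = 0) :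
      UEnv.Rel L
        (TensorAlgebra.ι ℂ x * TensorAlgebra.ι ℂ y + TensorAlgebra.ι ℂ y * TensorAlgebra.ι ℂ x)
        (TensorAlgebra.ι ℂ (⟨superBracket x y, L.bracket_mem x x.2 y y.2⟩ : L.toSubmodule))

/-- The universal enveloping (super)algebra `U(L)`. -/
def UEnv (L : LieSubSuperalgebra) : Type := RingQuot (UEnv.Rel L)

namespace UEnv

instance (L : LieSubSuperalgebra) : Ring (UEnv L) :=
  inferInstanceAs (Ring (RingQuot (UEnv.Rel L)))
instance (L : LieSubSuperalgebra) : Algebra ℂ (UEnv L) :=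
  inferInstanceAs (Algebra ℂ (RingQuot (UEnv.Rel L)))

/-- The canonical map `L → U(L)`. -/
def ι (L : LieSubSuperalgebra) : L.toSubmodule →ₗ[ℂ] UEnv L :=
  (RingQuot.mkAlgHom ℂ (UEnv.Rel L)).toLinearMap ∘ₗ TensorAlgebra.ι ℂ

variable {L : LieSubSuperalgebra}

theorem ι_comm (x y : L.toSubmodule) (h : oddPart x = 0 ∨ oddPart y = 0) :
    ι L x * ι L y - ι L y * ι L x = ι L ⟨superBracket x y, L.bracket_mem x x.2 y y.2⟩ := by
  have := RingQuot.mkAlgHom_rel ℂ (Rel.comm x y h)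
  rw [map_sub, map_mul, map_mul] at this
  exact this

theorem ι_anticomm (x y : L.toSubmodule) (hx : evenPart x = 0) (hy : evenPart y = 0) :
    ι L x * ι L y + ι L y * ι L x = ι L ⟨superBracket x y, L.bracket_mem x x.2 y y.2⟩ := by
  have := RingQuot.mkAlgHom_rel ℂ (Rel.anticomm x y hx hy)
  rw [map_add, map_mul, map_mul] at this
  exact this

/-- The universal property of `U(L)`. -/
def lift {A : Type*} [Ring A] [Algebra ℂ A] (φ : L.toSubmodule →ₗ[ℂ] A)
    (h₀ : ∀ x y : L.toSubmodule, (oddPart x = 0 ∨ oddPart y = 0) →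
      φ x * φ y - φ y * φ x = φ ⟨superBracket x y, L.bracket_mem x x.2 y y.2⟩)
    (h₁ : ∀ x y : L.toSubmodule, evenPart x = 0 → evenPart y = 0 →
      φ x * φ y + φ y * φ x = φ ⟨superBracket x y, L.bracket_mem x x.2 y y.2⟩) :
    UEnv L →ₐ[ℂ] A :=
  RingQuot.liftAlgHom ℂ ⟨TensorAlgebra.lift ℂ φ, by
    rintro _ _ (⟨x, y, h⟩ | ⟨x, y, hx, hy⟩)
    · simpa using h₀ x y h
    · simpa using h₁ x y hx hy⟩

theorem lift_ι {A : Type*} [Ring A] [Algebra ℂ A] (φ : L.toSubmodule →ₗ[ℂ] A) (h₀ h₁)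
    (x : L.toSubmodule) : lift φ h₀ h₁ (ι L x) = φ x := by
  refine (RingQuot.liftAlgHom_mkAlgHom_apply ℂ _ _ _).trans ?_
  exact TensorAlgebra.lift_ι_apply _ _

end UEnv

/-- The canonical map `U(G₀ ⊕ G₊₁) → U(G)`. -/
def inclP : UEnv P →ₐ[ℂ] UEnv G :=
  UEnv.lift (UEnv.ι G ∘ₗ Submodule.inclusion P_le_G)
    (fun x y h => UEnv.ι_comm (Submodule.inclusion P_le_G x) (Submodule.inclusion P_le_G y) h)
    (fun x y hx hy =>
      UEnv.ι_anticomm (Submodule.inclusion P_le_G x) (Submodule.inclusion P_le_G y) hx hy)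

/-- The projection `G₀ ⊕ G₊₁ → G₀`. -/
def projP : P.toSubmodule →ₗ[ℂ] G₀ where
  toFun x := ⟨evenPart x, by
    refine ⟨(P.evenPart_mem x x.2).1, ?_⟩
    ext i j
    by_cases h : (i = 2 ↔ j = 2) <;> simp [oddPart, evenPart, h]⟩
  map_add' x y := by ext1; simp
  map_smul' t x := by ext1; simp

theorem projP_bracket (x y : P.toSubmodule) :
    projP ⟨superBracket x y, P.bracket_mem x x.2 y y.2⟩ = ⁅projP x, projP y⁆ := by
  obtain ⟨x, hx, hx0, hx1⟩ := x
  obtain ⟨y, hy, hy0, hy1⟩ := y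
  ext i j
  fin_cases i <;> fin_cases j <;>
    simp [projP, superBracket, oddPart, evenPart, Ring.lie_def, Matrix.mul_apply,
      Fin.sum_univ_three, hx0, hx1, hy0, hy1]

section Induced

variable (W : Type*) [AddCommGroup W] [Module ℂ W] [LieRingModule G₀ W] [LieModule ℂ G₀ W]

/-- The extension of the `G₀`-module `W` to `U(G₀ ⊕ G₊₁)`, with `G₊₁` acting by zero. -/
def actP : UEnv P →ₐ[ℂ] Module.End ℂ W :=
  UEnv.lift ((LieModule.toEnd ℂ G₀ W).toLinearMap ∘ₗ projP)
    (fun x y _ => by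
      simp only [LinearMap.comp_apply, projP_bracket, LieHom.coe_toLinearMap, LieHom.map_lie]
      rfl)
    (fun x y hx hy => by
      have hx' : projP x = 0 := Subtype.ext hx
      have hy' : projP y = 0 := Subtype.ext hy
      simp [projP_bracket, hx', hy'])

/-- The kernel of `U(G) ⊗_ℂ W → U(G) ⊗_{U(G₀ ⊕ G₊₁)} W`. -/
def indRel : Submodule (UEnv G) (UEnv G ⊗[ℂ] W) :=
  Submodule.span (UEnv G)
    {t | ∃ (u : UEnv G) (r : UEnv P) (w : W), t = (u * inclP r) ⊗ₜ[ℂ] w - u ⊗ₜ[ℂ] actP W r w}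

/-- The induced module `U(G) ⊗_{U(G₀ ⊕ G₊₁)} W`, a left `U(G)`-module. -/
abbrev Induced : Type _ := (UEnv G ⊗[ℂ] W) ⧸ indRel W

/-- The canonical map of `W` to its induced module, `w ↦ 1 ⊗ w`. -/
def toInduced : W →ₗ[ℂ] Induced W :=
  ((indRel W).mkQ.restrictScalars ℂ) ∘ₗ TensorProduct.mk ℂ (UEnv G) W 1

variable {W} in
/-- A `G`-submodule of the induced module is permissible if it meets `W` trivially. -/
def IsPermissible (S : Submodule (UEnv G) (Induced W)) : Prop :=
  S.restrictScalars ℂ ⊓ LinearMap.range (toInduced W) = ⊥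

/-- The induced module of `W` is atypical if it has a nonzero permissible submodule. -/
def IsAtypical : Prop :=
  ∃ S : Submodule (UEnv G) (Induced W), S ≠ ⊥ ∧ IsPermissible S

end Induced

end SL21

end

noncomputable section

namespace SL21

namespace UEnv

/-! As a vector space the induced module is `W ⊕ f₂ W ⊕ f₃ W ⊕ f₂ f₃ W`. Instead of invoking a PBW
theorem, the action of `G` on four copies of `W` is written down, checked against the defining
relations (`modelAct_comm`, `modelAct_anticomm`), and shown to be inverse to the spanning map
`ofModel`.

Multiplying by suitable `f`'s puts some `f₂ f₃ w` with `w ≠ 0` into any nonzero submodule, and `e₂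
e₃` returns it to `topAct W w` in `W`. A permissible submodule therefore forces `topAct W w = 0`;
conversely such a `w` makes `f₂ f₃ w` generate a submodule that misses `W`. So atypicality means
that `topAct` has a kernel (`isAtypical_iff`).

With `h₁ + 2 h₂` acting as `c`, `4 topAct = casimir + 1 - (c + 1)²` (`four_smul_topAct`). On
`U(a,b,m)`, hence on any subquotient, `casimir - ((a - b)² - 1)` is nilpotent
(`UMod.casimir_sub_pow`). Thus `4 topAct` is a nilpotent operator plus the scalar `(a - b)² - (c +
1)²`, and on a nonzero space it has a kernel exactly when this scalar vanishes. -/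

theorem induction {L : LieSubSuperalgebra} {C : UEnv L → Prop}
    (algebraMap : ∀ r : ℂ, C (algebraMap ℂ (UEnv L) r)) (ι : ∀ x, C (ι L x))
    (mul : ∀ u v, C u → C v → C (u * v)) (add : ∀ u v, C u → C v → C (u + v))
    (u : UEnv L) : C u := by
  obtain ⟨t, rfl⟩ := RingQuot.mkAlgHom_surjective ℂ (UEnv.Rel L) u
  induction t using TensorAlgebra.induction with
  | algebraMap r =>
    rw [AlgHom.commutes]
    exact algebraMap r
  | ι x => exact ι x
  | mul s t hs ht =>
    rw [map_mul]
    exact mul _ _ hs ht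
  | add s t hs ht =>
    rw [map_add]
    exact add _ _ hs ht

end UEnv

/-! ### The even part -/

theorem oddPart_eq_zero_iff (x : Mat) :
    oddPart x = 0 ↔ x 0 2 = 0 ∧ x 1 2 = 0 ∧ x 2 0 = 0 ∧ x 2 1 = 0 := by
  rw [← Matrix.ext_iff]
  simp [oddPart, evenPart, Fin.forall_fin_succ]

theorem evenPart_eq_zero_iff (x : Mat) :
    evenPart x = 0 ↔ x 0 0 = 0 ∧ x 0 1 = 0 ∧ x 1 0 = 0 ∧ x 1 1 = 0 ∧ x 2 2 = 0 := by
  rw [← Matrix.ext_iff]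
  simp [evenPart, Fin.forall_fin_succ]
  tauto

theorem apply_two_two_of_supertrace {x : Mat} (hx : supertrace x = 0) :
    x 2 2 = x 0 0 + x 1 1 := by
  simp only [supertrace, LinearMap.coe_mk, AddHom.coe_mk] at hx
  linear_combination -hx

namespace G₀

def e : G₀ := ⟨e₁, by simp [supertrace, e₁], by simp [oddPart_eq_zero_iff, e₁]⟩
def f : G₀ := ⟨f₁, by simp [supertrace, f₁], by simp [oddPart_eq_zero_iff, f₁]⟩
/-- `h₂ = diag(0, 1, 1)`. -/
def h2 : G₀ := ⟨h₂, by simp [supertrace, h₂], (oddPart_eq_zero_iff _).2 (by simp [h₂])⟩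
/-- `h₁ + h₂ = diag(1, 0, 1)`. -/
def h3 : G₀ :=
  ⟨h₁ + h₂, by simp [supertrace, h₁, h₂], (oddPart_eq_zero_iff _).2 (by simp [h₁, h₂])⟩

/-- The diagonal basis `h3`, `h2` is adapted to the odd part: `h2 = [e₂, f₂]` and `h3 = [e₃, f₃]`,
with the diagonal entries `y 0 0` and `y 1 1` as coordinates. -/
theorem eq_combination (y : G₀) :
    y = (y : Mat) 0 1 • e + (y : Mat) 1 0 • f + (y : Mat) 0 0 • h3 + (y : Mat) 1 1 • h2 := by
  obtain ⟨y, hy, hy'⟩ := y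
  have := apply_two_two_of_supertrace hy
  obtain ⟨h1, h2, h3, h4⟩ := (oddPart_eq_zero_iff y).1 hy'
  ext i j
  fin_cases i <;> fin_cases j <;>
    simp [e, f, G₀.h2, G₀.h3, e₁, f₁, h₁, h₂, *]

theorem cc_eq : cc = h3 + h2 := by
  ext i j
  fin_cases i <;> fin_cases j <;>
    simp [cc, G₀.h2, G₀.h3, h₁, h₂] <;> norm_num

theorem lie_e_f : ⁅e, f⁆ = h3 - h2 := by
  ext i j
  fin_cases i <;> fin_cases j <;>
    simp [e, f, h2, h3, e₁, f₁, h₁, h₂, Ring.lie_def]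

theorem lie_h2_e : ⁅h2, e⁆ = -e := by
  ext i j
  fin_cases i <;> fin_cases j <;>
    simp [e, h2, e₁, h₂, Ring.lie_def, Matrix.mul_apply, Fin.sum_univ_three]

theorem lie_h2_f : ⁅h2, f⁆ = f := by
  ext i j
  fin_cases i <;> fin_cases j <;>
    simp [f, h2, f₁, h₂, Ring.lie_def, Matrix.mul_apply, Fin.sum_univ_three]

theorem lie_h3_e : ⁅h3, e⁆ = e := by
  ext i j
  fin_cases i <;> fin_cases j <;>
    simp [e, h3, e₁, h₁, h₂, Ring.lie_def, Matrix.mul_apply, Fin.sum_univ_three]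

theorem lie_h3_f : ⁅h3, f⁆ = -f := by
  ext i j
  fin_cases i <;> fin_cases j <;>
    simp [f, h3, f₁, h₁, h₂, Ring.lie_def, Matrix.mul_apply, Fin.sum_univ_three]

theorem lie_h3_h2 : ⁅h3, h2⁆ = 0 := by
  ext i j
  fin_cases i <;> fin_cases j <;>
    simp [h2, h3, h₁, h₂, Ring.lie_def, Matrix.mul_apply, Fin.sum_univ_three]

section Module

variable {W : Type*} [AddCommGroup W] [LieRingModule G₀ W]

/-! Rules bringing the action of monomials in `e, f, h3, h2` into the order `e f h3 h2`. -/

theorem f_e (w : W) : ⁅f, ⁅e, w⁆⁆ = ⁅e, ⁅f, w⁆⁆ - ⁅h3, w⁆ + ⁅h2, w⁆ := by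
  have := lie_lie e f w
  rw [lie_e_f, sub_lie] at this
  rw [eq_sub_of_add_eq' (sub_eq_iff_eq_add.1 this.symm).symm]
  abel

theorem h2_e (w : W) : ⁅h2, ⁅e, w⁆⁆ = ⁅e, ⁅h2, w⁆⁆ - ⁅e, w⁆ := by
  rw [leibniz_lie h2 e w, lie_h2_e, neg_lie]
  abel

theorem h2_f (w : W) : ⁅h2, ⁅f, w⁆⁆ = ⁅f, ⁅h2, w⁆⁆ + ⁅f, w⁆ := by
  rw [leibniz_lie h2 f w, lie_h2_f]
  abel

theorem h3_e (w : W) : ⁅h3, ⁅e, w⁆⁆ = ⁅e, ⁅h3, w⁆⁆ + ⁅e, w⁆ := by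
  rw [leibniz_lie h3 e w, lie_h3_e]
  abel

theorem h3_f (w : W) : ⁅h3, ⁅f, w⁆⁆ = ⁅f, ⁅h3, w⁆⁆ - ⁅f, w⁆ := by
  rw [leibniz_lie h3 f w, lie_h3_f, neg_lie]
  abel

theorem h2_h3 (w : W) : ⁅h2, ⁅h3, w⁆⁆ = ⁅h3, ⁅h2, w⁆⁆ := by
  rw [leibniz_lie h3 h2 w, lie_h3_h2, zero_lie, zero_add]

end Module

end G₀

/-! ### An explicit model of the induced module -/

section Model

variable (W : Type*) [AddCommGroup W] [Module ℂ W] [LieRingModule G₀ W] [LieModule ℂ G₀ W]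

/-- The linear extension to all matrices of the action of `G₀` on `W`. -/
def evenAct : Mat →ₗ[ℂ] Module.End ℂ W :=
  LinearMap.mk₂ ℂ
    (fun x w => x 0 1 • ⁅G₀.e, w⁆ + x 1 0 • ⁅G₀.f, w⁆ + x 0 0 • ⁅G₀.h3, w⁆ + x 1 1 • ⁅G₀.h2, w⁆)
    (by intros; simp only [Matrix.add_apply]; module)
    (by intros; simp only [Matrix.smul_apply, smul_eq_mul]; module)
    (by intros; simp only [lie_add]; module)
    (by intros; simp only [lie_smul]; module)

variable {W} in
theorem evenAct_apply (x : Mat) (w : W) : evenAct W x w =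
    x 0 1 • ⁅G₀.e, w⁆ + x 1 0 • ⁅G₀.f, w⁆ + x 0 0 • ⁅G₀.h3, w⁆ + x 1 1 • ⁅G₀.h2, w⁆ := rfl

variable {W} in
theorem evenAct_coe (y : G₀) (w : W) : evenAct W y w = ⁅y, w⁆ := by
  conv_rhs => rw [G₀.eq_combination y]
  simp only [add_lie, smul_lie]
  rfl

/-- The action of `G` on `W ⊕ f₂ W ⊕ f₃ W ⊕ f₂ f₃ W`. -/
def modelAct : Mat →ₗ[ℂ] Module.End ℂ (W × W × W × W) :=
  LinearMap.mk₂ ℂ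
    (fun x v =>
      -- The components are the coefficients of `1`, `f₂`, `f₃`, `f₂ f₃` obtained by moving `x` to
      -- the right past the `f`'s, with `e₂` and `e₃` vanishing on `W`.
      (evenAct W x v.1 + x 1 2 • (⁅G₀.h2, v.2.1⁆ + ⁅G₀.f, v.2.2.1⁆)
          + x 0 2 • (⁅G₀.e, v.2.1⁆ + ⁅G₀.h3, v.2.2.1⁆),
        evenAct W x v.2.1 + x 0 0 • v.2.1 - x 0 1 • v.2.2.1 + x 2 1 • v.1
          - x 1 2 • ⁅G₀.f, v.2.2.2⁆ - x 0 2 • (⁅G₀.h3, v.2.2.2⁆ + v.2.2.2),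
        evenAct W x v.2.2.1 + x 1 1 • v.2.2.1 - x 1 0 • v.2.1 + x 2 0 • v.1
          + x 1 2 • (⁅G₀.h2, v.2.2.2⁆ + v.2.2.2) + x 0 2 • ⁅G₀.e, v.2.2.2⁆,
        evenAct W x v.2.2.2 + (x 0 0 + x 1 1) • v.2.2.2 + x 2 1 • v.2.2.1 - x 2 0 • v.2.1))
    (by
      intros
      ext <;> simp only [map_add, LinearMap.add_apply, Matrix.add_apply, Prod.fst_add,
        Prod.snd_add] <;> module)
    (by
      intros
      ext <;> simp only [map_smul, LinearMap.smul_apply, Matrix.smul_apply, Prod.smul_fst,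
        Prod.smul_snd, smul_eq_mul] <;> module)
    (by
      intros
      ext <;> simp only [map_add, lie_add, Prod.fst_add, Prod.snd_add] <;> module)
    (by
      intros
      ext <;> simp only [map_smul, lie_smul, Prod.smul_fst, Prod.smul_snd] <;> module)

variable {W} in
theorem modelAct_apply (x : Mat) (w₀ w₁ w₂ w₃ : W) : modelAct W x (w₀, w₁, w₂, w₃) =
    (evenAct W x w₀ + x 1 2 • (⁅G₀.h2, w₁⁆ + ⁅G₀.f, w₂⁆) + x 0 2 • (⁅G₀.e, w₁⁆ + ⁅G₀.h3, w₂⁆),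
      evenAct W x w₁ + x 0 0 • w₁ - x 0 1 • w₂ + x 2 1 • w₀
        - x 1 2 • ⁅G₀.f, w₃⁆ - x 0 2 • (⁅G₀.h3, w₃⁆ + w₃),
      evenAct W x w₂ + x 1 1 • w₂ - x 1 0 • w₁ + x 2 0 • w₀
        + x 1 2 • (⁅G₀.h2, w₃⁆ + w₃) + x 0 2 • ⁅G₀.e, w₃⁆,
      evenAct W x w₃ + (x 0 0 + x 1 1) • w₃ + x 2 1 • w₂ - x 2 0 • w₁) := rfl

/-- Once the monomials in `e, f, h3, h2` are put in a fixed order, it suffices to compare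
coefficients. Supertrace zero eliminates the `(2, 2)` entries, which occur in the matrix products
but are ignored by `modelAct`. -/
theorem modelAct_comm_of_even (x y : Mat) (hx : supertrace x = 0) (hy : supertrace y = 0)
    (h : oddPart x = 0) :
    modelAct W x * modelAct W y - modelAct W y * modelAct W x = modelAct W (superBracket x y) := by
  obtain ⟨h1, h2, h3, h4⟩ := (oddPart_eq_zero_iff x).1 h
  have hx := apply_two_two_of_supertrace hx
  have hy := apply_two_two_of_supertrace hy
  refine LinearMap.ext fun ⟨w₀, w₁, w₂, w₃⟩ => ?_
  simp only [LinearMap.sub_apply, Module.End.mul_apply, modelAct_apply, evenAct_apply,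
    superBracket, h, mul_zero, smul_zero, add_zero, Matrix.sub_apply, Matrix.mul_apply,
    Fin.sum_univ_three, h1, h2, h3, h4, zero_smul, zero_mul, zero_add, sub_zero,
    hx, hy, lie_add, lie_sub, lie_smul, Prod.mk_sub_mk,
    G₀.f_e, G₀.h2_e, G₀.h2_f, G₀.h3_e, G₀.h3_f, G₀.h2_h3]
  ext <;> simp only <;> module

theorem superBracket_swap_of_even {x y : Mat} (h : oddPart y = 0) :
    superBracket x y = - superBracket y x := by
  simp [superBracket, h]

theorem modelAct_comm (x y : Mat) (hx : supertrace x = 0) (hy : supertrace y = 0)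
    (h : oddPart x = 0 ∨ oddPart y = 0) :
    modelAct W x * modelAct W y - modelAct W y * modelAct W x = modelAct W (superBracket x y) := by
  rcases h with h | h
  · exact modelAct_comm_of_even W x y hx hy h
  · rw [superBracket_swap_of_even h, map_neg, ← modelAct_comm_of_even W y x hy hx h, neg_sub]

theorem modelAct_anticomm (x y : Mat) (hx : evenPart x = 0) (hy : evenPart y = 0) :
    modelAct W x * modelAct W y + modelAct W y * modelAct W x = modelAct W (superBracket x y) := by
  have h : superBracket x y = x * y + y * x := by
    simp only [superBracket, oddPart, LinearMap.sub_apply, LinearMap.id_apply, hx, hy, sub_zero]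
    module
  rw [h]
  obtain ⟨x1, x2, x3, x4, x5⟩ := (evenPart_eq_zero_iff x).1 hx
  obtain ⟨y1, y2, y3, y4, y5⟩ := (evenPart_eq_zero_iff y).1 hy
  refine LinearMap.ext fun ⟨w₀, w₁, w₂, w₃⟩ => ?_
  simp only [LinearMap.add_apply, Module.End.mul_apply, modelAct_apply, evenAct_apply,
    Matrix.add_apply, Matrix.mul_apply, mul_zero,
    Fin.sum_univ_three, x1, x2, x3, x4, x5, y1, y2, y3, y4, y5, zero_smul, zero_mul, zero_add,
    add_zero, sub_zero,
    lie_add, lie_sub, lie_smul, Prod.mk_add_mk,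
    G₀.f_e, G₀.h2_e, G₀.h2_f, G₀.h3_e, G₀.h3_f, G₀.h2_h3]
  ext <;> simp only <;> module

/-- The representation of `U(G)` on `W ⊕ f₂ W ⊕ f₃ W ⊕ f₂ f₃ W`. -/
def modelRep : UEnv G →ₐ[ℂ] Module.End ℂ (W × W × W × W) :=
  UEnv.lift (modelAct W ∘ₗ G.toSubmodule.subtype)
    (fun x y h => modelAct_comm W x y x.2 y.2 h)
    (fun x y hx hy => modelAct_anticomm W x y hx hy)

theorem modelRep_ι (x : G.toSubmodule) : modelRep W (UEnv.ι G x) = modelAct W x :=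
  UEnv.lift_ι _ _ _ _

end Model

/-! ### The generators of `U(G)` -/

namespace UEnv

def ofG₀ (y : G₀) : UEnv G := ι G ⟨y, y.2.1⟩
def e2 : UEnv G := ι G ⟨e₂, by simp [G, supertrace, e₂]⟩
def e3 : UEnv G := ι G ⟨e₃, by simp [G, supertrace, e₃]⟩
def f2 : UEnv G := ι G ⟨f₂, by simp [G, supertrace, f₂]⟩
def f3 : UEnv G := ι G ⟨f₃, by simp [G, supertrace, f₃]⟩

theorem ι_eq_combination (x : G.toSubmodule) :
    ι G x = (x : Mat) 0 1 • ofG₀ G₀.e + (x : Mat) 1 0 • ofG₀ G₀.f + (x : Mat) 0 0 • ofG₀ G₀.h3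
      + (x : Mat) 1 1 • ofG₀ G₀.h2 + (x : Mat) 1 2 • e2 + (x : Mat) 0 2 • e3
      + (x : Mat) 2 1 • f2 + (x : Mat) 2 0 • f3 := by
  have := apply_two_two_of_supertrace x.2
  simp only [ofG₀, e2, e3, f2, f3, ← map_smul, ← map_add]
  congr 1
  ext i j
  fin_cases i <;> fin_cases j <;>
    simp [G₀.e, G₀.f, G₀.h2, G₀.h3, e₁, e₂, e₃, f₁, f₂, f₃, h₁, h₂, this]

theorem ι_mul_of_even {x y z : G.toSubmodule} (h : oddPart x = 0)
    (hz : superBracket x y = z) : ι G x * ι G y = ι G y * ι G x + ι G z := by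
  rw [← sub_eq_iff_eq_add', ι_comm x y (Or.inl h)]
  exact congrArg _ (Subtype.ext hz)

theorem ι_mul_of_odd {x y z : G.toSubmodule} (hx : evenPart x = 0) (hy : evenPart y = 0)
    (hz : superBracket x y = z) : ι G x * ι G y = ι G z - ι G y * ι G x := by
  rw [eq_sub_iff_add_eq, ι_anticomm x y hx hy]
  exact congrArg _ (Subtype.ext hz)

section Relations

variable {M : Type*} [AddCommGroup M] [Module (UEnv G) M] (t : M)

/-- This and the following relations are stated on a vector `t`, so that they rewrite nested actions
and push even elements, `e₂` and `e₃` rightwards past `f₂` and `f₃`. -/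
theorem ofG₀_f2 (y : G₀) : ofG₀ y • f2 • t =
    f2 • ofG₀ y • t + ((y : Mat) 0 0 • f2) • t - ((y : Mat) 1 0 • f3) • t := by
  have hy := apply_two_two_of_supertrace y.2.1
  obtain ⟨h1, h2, h3, h4⟩ := (oddPart_eq_zero_iff y).1 y.2.2
  have : ofG₀ y * f2 = f2 * ofG₀ y + ((y : Mat) 0 0 • f2 - (y : Mat) 1 0 • f3) := by
    simp only [f2, f3, ← map_smul, ← map_sub]
    refine ι_mul_of_even y.2.2 ?_
    simp only [superBracket, y.2.2]
    ext i j
    fin_cases i <;> fin_cases j <;>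
      simp [f₂, f₃, Matrix.mul_apply, Fin.sum_univ_three, hy, h1, h2, h3, h4]
  rw [← mul_smul, this, add_smul, mul_smul, sub_smul, add_sub_assoc]

theorem ofG₀_f3 (y : G₀) : ofG₀ y • f3 • t =
    f3 • ofG₀ y • t + ((y : Mat) 1 1 • f3) • t - ((y : Mat) 0 1 • f2) • t := by
  have hy := apply_two_two_of_supertrace y.2.1
  obtain ⟨h1, h2, h3, h4⟩ := (oddPart_eq_zero_iff y).1 y.2.2
  have : ofG₀ y * f3 = f3 * ofG₀ y + ((y : Mat) 1 1 • f3 - (y : Mat) 0 1 • f2) := by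
    simp only [f2, f3, ← map_smul, ← map_sub]
    refine ι_mul_of_even y.2.2 ?_
    simp only [superBracket, y.2.2]
    ext i j
    fin_cases i <;> fin_cases j <;>
      simp [f₂, f₃, Matrix.mul_apply, Fin.sum_univ_three, hy, h1, h2, h3, h4]
  rw [← mul_smul, this, add_smul, mul_smul, sub_smul, add_sub_assoc]

theorem superBracket_of_odd {x y : Mat} (hx : evenPart x = 0) (hy : evenPart y = 0) :
    superBracket x y = x * y + y * x := by
  simp only [superBracket, oddPart, LinearMap.sub_apply, LinearMap.id_apply, hx, hy, sub_zero]
  module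

theorem evenPart_e₂ : evenPart e₂ = 0 := by simp [evenPart_eq_zero_iff, e₂]
theorem evenPart_e₃ : evenPart e₃ = 0 := by simp [evenPart_eq_zero_iff, e₃]
theorem evenPart_f₂ : evenPart f₂ = 0 := by simp [evenPart_eq_zero_iff, f₂]
theorem evenPart_f₃ : evenPart f₃ = 0 := by simp [evenPart_eq_zero_iff, f₃]

theorem e2_f2 : e2 • f2 • t = ofG₀ G₀.h2 • t - f2 • e2 • t := by
  simp only [← mul_smul, ← sub_smul]
  congr 1
  refine ι_mul_of_odd evenPart_e₂ evenPart_f₂ ?_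
  rw [superBracket_of_odd evenPart_e₂ evenPart_f₂]
  simp [e₂, f₂, h₂, G₀.h2]

theorem e2_f3 : e2 • f3 • t = ofG₀ G₀.f • t - f3 • e2 • t := by
  simp only [← mul_smul, ← sub_smul]
  congr 1
  refine ι_mul_of_odd evenPart_e₂ evenPart_f₃ ?_
  rw [superBracket_of_odd evenPart_e₂ evenPart_f₃]
  simp [e₂, f₃, f₁, G₀.f]

theorem e3_f2 : e3 • f2 • t = ofG₀ G₀.e • t - f2 • e3 • t := by
  simp only [← mul_smul, ← sub_smul]
  congr 1
  refine ι_mul_of_odd evenPart_e₃ evenPart_f₂ ?_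
  rw [superBracket_of_odd evenPart_e₃ evenPart_f₂]
  simp [e₃, f₂, e₁, G₀.e]

theorem e3_f3 : e3 • f3 • t = ofG₀ G₀.h3 • t - f3 • e3 • t := by
  simp only [← mul_smul, ← sub_smul]
  congr 1
  refine ι_mul_of_odd evenPart_e₃ evenPart_f₃ ?_
  rw [superBracket_of_odd evenPart_e₃ evenPart_f₃]
  simp [e₃, f₃, h₁, h₂, G₀.h3]
  abel

theorem f3_f2 : f3 • f2 • t = -(f2 • f3 • t) := by
  simp only [← mul_smul, ← neg_smul]
  congr 1
  rw [← zero_sub, ← map_zero (ι G)]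
  refine ι_mul_of_odd evenPart_f₃ evenPart_f₂ ?_
  rw [superBracket_of_odd evenPart_f₃ evenPart_f₂]
  simp [f₂, f₃]

/-- For odd `f₂` the superbracket with itself is twice the square, and the matrix `f₂` squares to
zero. -/
theorem f2_f2 : f2 • f2 • t = 0 := by
  rw [← mul_smul, ← zero_smul (UEnv G) t]
  congr 1
  have h : f2 * f2 = 0 - f2 * f2 := by
    rw [← map_zero (ι G)]
    refine ι_mul_of_odd evenPart_f₂ evenPart_f₂ ?_
    rw [superBracket_of_odd evenPart_f₂ evenPart_f₂]
    simp [f₂]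
  rw [zero_sub, eq_neg_iff_add_eq_zero, ← two_smul ℂ] at h
  exact (smul_eq_zero.1 h).resolve_left two_ne_zero

theorem f3_f3 : f3 • f3 • t = 0 := by
  rw [← mul_smul, ← zero_smul (UEnv G) t]
  congr 1
  have h : f3 * f3 = 0 - f3 * f3 := by
    rw [← map_zero (ι G)]
    refine ι_mul_of_odd evenPart_f₃ evenPart_f₃ ?_
    rw [superBracket_of_odd evenPart_f₃ evenPart_f₃]
    simp [f₃]
  rw [zero_sub, eq_neg_iff_add_eq_zero, ← two_smul ℂ] at h
  exact (smul_eq_zero.1 h).resolve_left two_ne_zero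

end Relations

end UEnv

/-! ### Comparison of the induced module with its model -/

section Comparison

open UEnv

variable (W : Type*) [AddCommGroup W] [Module ℂ W] [LieRingModule G₀ W] [LieModule ℂ G₀ W]

variable {W} in
theorem inclP_smul_toInduced (r : UEnv P) (w : W) :
    inclP r • toInduced W w = toInduced W (actP W r w) := by
  refine (Submodule.Quotient.eq (indRel W)).2 (Submodule.subset_span ⟨1, r, w, ?_⟩)
  change inclP r • ((1 : UEnv G) ⊗ₜ[ℂ] w) - _ = _
  rw [TensorProduct.smul_tmul', smul_eq_mul, mul_one, one_mul]
  rfl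

variable {W} in
theorem ι_smul_toInduced (x : P.toSubmodule) (w : W) :
    ι G (Submodule.inclusion P_le_G x) • toInduced W w = toInduced W ⁅projP x, w⁆ := by
  have h : inclP (ι P x) = ι G (Submodule.inclusion P_le_G x) := lift_ι _ _ _ _
  have h' : actP W (ι P x) = LieModule.toEnd ℂ G₀ W (projP x) := lift_ι _ _ _ _
  rw [← h, inclP_smul_toInduced, h']
  rfl

variable {W} in
theorem ofG₀_smul_toInduced (y : G₀) (w : W) :
    ofG₀ y • toInduced W w = toInduced W ⁅y, w⁆ := by
  obtain ⟨h1, h2, h3, h4⟩ := (oddPart_eq_zero_iff y).1 y.2.2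
  have h : projP ⟨y, y.2.1, h3, h4⟩ = y :=
    Subtype.ext (sub_eq_zero.1 y.2.2).symm
  have := ι_smul_toInduced ⟨y, y.2.1, h3, h4⟩ w
  rwa [h] at this

variable {W} in
theorem e2_smul_toInduced (w : W) : e2 • toInduced W w = 0 := by
  have h : projP ⟨e₂, by simp [supertrace, e₂], by simp [e₂], by simp [e₂]⟩ = 0 :=
    Subtype.ext evenPart_e₂
  have := ι_smul_toInduced ⟨e₂, by simp [supertrace, e₂], by simp [e₂], by simp [e₂]⟩ w
  rwa [h, zero_lie, map_zero] at this

variable {W} in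
theorem e3_smul_toInduced (w : W) : e3 • toInduced W w = 0 := by
  have h : projP ⟨e₃, by simp [supertrace, e₃], by simp [e₃], by simp [e₃]⟩ = 0 :=
    Subtype.ext evenPart_e₃
  have := ι_smul_toInduced ⟨e₃, by simp [supertrace, e₃], by simp [e₃], by simp [e₃]⟩ w
  rwa [h, zero_lie, map_zero] at this

/-- `(w₀, w₁, w₂, w₃) ↦ w₀ + f₂ w₁ + f₃ w₂ + f₂ f₃ w₃`. -/
def ofModel : W × W × W × W →ₗ[ℂ] Induced W where
  toFun v := toInduced W v.1 + f2 • toInduced W v.2.1 + f3 • toInduced W v.2.2.1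
    + f2 • f3 • toInduced W v.2.2.2
  map_add' u v := by
    simp only [Prod.fst_add, Prod.snd_add, map_add, smul_add]
    abel
  map_smul' t v := by
    simp only [Prod.smul_fst, Prod.smul_snd, map_smul, smul_comm _ t, smul_add, RingHom.id_apply]

variable {W} in
theorem ofModel_apply (w₀ w₁ w₂ w₃ : W) : ofModel W (w₀, w₁, w₂, w₃) =
    toInduced W w₀ + f2 • toInduced W w₁ + f3 • toInduced W w₂
      + f2 • f3 • toInduced W w₃ := rfl

variable {W} in
-- This justifies the formulas of `modelAct`: the relations in `U(G)` straighten `x f₂`, `x f₃` and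
-- `x f₂ f₃` into exactly those components.
theorem ofModel_modelAct (x : G.toSubmodule) (v : W × W × W × W) :
    ofModel W (modelAct W x v) = ι G x • ofModel W v := by
  obtain ⟨w₀, w₁, w₂, w₃⟩ := v
  rw [ι_eq_combination]
  generalize (x : Mat) = x
  simp only [modelAct_apply, evenAct_apply, ofModel_apply, smul_add, add_smul, smul_assoc,
    ofG₀_f2, ofG₀_f3, e2_f2, e2_f3, e3_f2, e3_f3, f3_f2, f2_f2, f3_f3, ofG₀_smul_toInduced,
    e2_smul_toInduced, e3_smul_toInduced, smul_zero, sub_zero, map_add, map_sub, map_smul,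
    smul_sub, smul_neg, smul_comm (_ : UEnv G) (_ : ℂ)]
  simp [G₀.e, G₀.f, G₀.h2, G₀.h3, e₁, f₁, h₁, h₂]
  -- Viewing elements of `U(G)` as linear operators leaves `module` with complex scalars only.
  have h (u : UEnv G) (t : Induced W) : u • t = Algebra.lsmul ℂ ℂ (Induced W) u t := rfl
  simp only [h]
  module

variable {W} in
theorem ofModel_modelRep (u : UEnv G) (v : W × W × W × W) :
    ofModel W (modelRep W u v) = u • ofModel W v := by
  induction u using UEnv.induction generalizing v with
  | algebraMap r => simp
  | ι x => rw [modelRep_ι, ofModel_modelAct]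
  | mul u u' h h' => rw [map_mul, Module.End.mul_apply, h, h', mul_smul]
  | add u u' h h' => rw [map_add, LinearMap.add_apply, map_add, h, h', add_smul]

/-- `u ⊗ w ↦ u (w, 0, 0, 0)`. -/
def tensorToModel : UEnv G ⊗[ℂ] W →ₗ[ℂ] W × W × W × W :=
  TensorProduct.lift
    ((LinearMap.lcomp ℂ (W × W × W × W) (LinearMap.inl ℂ W (W × W × W))).comp
      (modelRep W).toLinearMap)

variable {W} in
theorem tensorToModel_tmul (u : UEnv G) (w : W) :
    tensorToModel W (u ⊗ₜ w) = modelRep W u (w, 0, 0, 0) := rfl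

variable {W} in
theorem tensorToModel_smul (u : UEnv G) (t : UEnv G ⊗[ℂ] W) :
    tensorToModel W (u • t) = modelRep W u (tensorToModel W t) := by
  induction t using TensorProduct.induction_on with
  | zero => simp
  | tmul u' w =>
    rw [TensorProduct.smul_tmul', smul_eq_mul, tensorToModel_tmul, map_mul, Module.End.mul_apply,
      tensorToModel_tmul]
  | add s t hs ht => rw [smul_add, map_add, hs, ht, map_add, map_add]

variable {W} in
-- The first copy of `W` carries the prescribed action of `G₀ ⊕ G₊₁`, which is why `tensorToModel`
-- kills the relations of the induced module.
theorem modelRep_inclP (r : UEnv P) (w : W) :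
    modelRep W (inclP r) (w, 0, 0, 0) = (actP W r w, 0, 0, 0) := by
  induction r using UEnv.induction generalizing w with
  | algebraMap r => simp [Algebra.algebraMap_eq_smul_one]
  | ι x =>
    have h : inclP (ι P x) = ι G (Submodule.inclusion P_le_G x) := lift_ι _ _ _ _
    have h' : actP W (ι P x) = LieModule.toEnd ℂ G₀ W (projP x) := lift_ι _ _ _ _
    rw [h, h', modelRep_ι, modelAct_apply, LieModule.toEnd_apply_apply, ← evenAct_coe (projP x)]
    obtain ⟨x, hx, h0, h1⟩ := x
    simp [h0, h1, evenAct_apply, projP, evenPart]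
  | mul r r' h h' => simp only [map_mul, Module.End.mul_apply, h, h']
  | add r r' h h' => simp only [map_add, LinearMap.add_apply, h, h', Prod.mk_add_mk, add_zero]

theorem indRel_le_ker : (indRel W).restrictScalars ℂ ≤ LinearMap.ker (tensorToModel W) := by
  intro t ht
  replace ht : t ∈ indRel W := ht
  rw [LinearMap.mem_ker]
  induction ht using Submodule.span_induction with
  | mem t h =>
    obtain ⟨u, r, w, rfl⟩ := h
    rw [map_sub, tensorToModel_tmul, tensorToModel_tmul, map_mul, Module.End.mul_apply,
      modelRep_inclP, sub_self]
  | zero => exact map_zero _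
  | add s t hs ht h h' => rw [map_add, h, h', add_zero]
  | smul u t ht h => rw [tensorToModel_smul, h, map_zero]

/-- The inverse of `ofModel`. -/
def toModel : Induced W →ₗ[ℂ] W × W × W × W :=
  ((indRel W).restrictScalars ℂ).liftQ (tensorToModel W) (indRel_le_ker W) ∘ₗ
    (Submodule.Quotient.restrictScalarsEquiv ℂ (indRel W)).symm.toLinearMap

variable {W} in
theorem toModel_mk (t : UEnv G ⊗[ℂ] W) :
    toModel W (Submodule.Quotient.mk t) = tensorToModel W t := rfl

variable {W} in
theorem toModel_smul (u : UEnv G) (t : Induced W) :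
    toModel W (u • t) = modelRep W u (toModel W t) := by
  obtain ⟨t, rfl⟩ := Submodule.Quotient.mk_surjective _ t
  rw [← Submodule.Quotient.mk_smul, toModel_mk, toModel_mk, tensorToModel_smul]

variable {W} in
theorem toModel_toInduced (w : W) : toModel W (toInduced W w) = (w, 0, 0, 0) := by
  refine (tensorToModel_tmul 1 w).trans ?_
  rw [map_one, Module.End.one_apply]

variable {W} in
-- This is the PBW-type independence: the four summands of the induced module are direct, each a
-- copy of `W`.
theorem toModel_ofModel (v : W × W × W × W) : toModel W (ofModel W v) = v := by
  obtain ⟨w₀, w₁, w₂, w₃⟩ := v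
  simp only [ofModel_apply, map_add, toModel_smul, toModel_toInduced, f2, f3, modelRep_ι,
    modelAct_apply]
  simp [f₂, f₃, evenAct_apply]

variable {W} in
theorem ofModel_toModel (t : Induced W) : ofModel W (toModel W t) = t := by
  obtain ⟨t, rfl⟩ := Submodule.Quotient.mk_surjective _ t
  rw [toModel_mk]
  induction t using TensorProduct.induction_on with
  | zero => simp
  | tmul u w =>
    rw [tensorToModel_tmul, ofModel_modelRep]
    have : ofModel W (w, 0, 0, 0) = toInduced W w := by simp [ofModel_apply]
    rw [this]
    change Submodule.Quotient.mk (u • (1 : UEnv G) ⊗ₜ[ℂ] w) = _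
    rw [TensorProduct.smul_tmul', smul_eq_mul, mul_one]
  | add s t hs ht => rw [map_add, map_add, hs, ht, Submodule.Quotient.mk_add]

end Comparison

/-! ### Atypicality in terms of the action of `e₂ e₃ f₂ f₃` -/

section Atypical

open UEnv

variable (W : Type*) [AddCommGroup W] [Module ℂ W] [LieRingModule G₀ W] [LieModule ℂ G₀ W]

/-- The action of `e₂ e₃ f₂ f₃` on `W`. -/
def topAct : Module.End ℂ W where
  toFun w := ⁅G₀.f, ⁅G₀.e, w⁆⁆ - ⁅G₀.h2, ⁅G₀.h3, w⁆⁆ - ⁅G₀.h2, w⁆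
  map_add' u v := by
    simp only [lie_add]
    abel
  map_smul' t u := by
    simp only [lie_smul, smul_sub, RingHom.id_apply]

variable {W} in
theorem topAct_apply (w : W) : topAct W w =
    ⁅G₀.f, ⁅G₀.e, w⁆⁆ - ⁅G₀.h2, ⁅G₀.h3, w⁆⁆ - ⁅G₀.h2, w⁆ := rfl

variable {W} in
theorem e2_e3_f2_f3_smul_toInduced (w : W) :
    e2 • e3 • f2 • f3 • toInduced W w = toInduced W (topAct W w) := by
  simp only [ofG₀_f3, e2_f2, e2_f3, e3_f2, e3_f3, ofG₀_smul_toInduced,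
    e2_smul_toInduced, e3_smul_toInduced, smul_zero, sub_zero, map_sub,
    smul_sub, smul_add, topAct_apply, smul_assoc, smul_comm (_ : UEnv G) (_ : ℂ)]
  simp [G₀.e, e₁]
  abel

/-- The hypotheses say that `e₂` and `e₃` kill `f₂ w₁ + f₃ w₂` and that `e₂ e₃` kills `f₂ f₃ w₃`.
These vectors form a `G`-stable space with zero component in `W`. -/
theorem modelAct_mem {x : Mat} {w₁ w₂ w₃ : W} (hp : ⁅G₀.h2, w₁⁆ + ⁅G₀.f, w₂⁆ = 0)
    (hq : ⁅G₀.e, w₁⁆ + ⁅G₀.h3, w₂⁆ = 0) (hT : topAct W w₃ = 0) :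
    ∃ v₁ v₂ v₃ : W, modelAct W x (0, w₁, w₂, w₃) = (0, v₁, v₂, v₃) ∧
      ⁅G₀.h2, v₁⁆ + ⁅G₀.f, v₂⁆ = 0 ∧ ⁅G₀.e, v₁⁆ + ⁅G₀.h3, v₂⁆ = 0 ∧ topAct W v₃ = 0 := by
  have hAp : evenAct W x (⁅G₀.h2, w₁⁆ + ⁅G₀.f, w₂⁆) = 0 := by rw [hp, map_zero]
  have hAq : evenAct W x (⁅G₀.e, w₁⁆ + ⁅G₀.h3, w₂⁆) = 0 := by rw [hq, map_zero]
  have hAT : evenAct W x (topAct W w₃) = 0 := by rw [hT, map_zero]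
  have hep : ⁅G₀.e, ⁅G₀.h2, w₁⁆ + ⁅G₀.f, w₂⁆⁆ = 0 := by rw [hp, lie_zero]
  have hh3p : ⁅G₀.h3, ⁅G₀.h2, w₁⁆ + ⁅G₀.f, w₂⁆⁆ = 0 := by rw [hp, lie_zero]
  have hfq : ⁅G₀.f, ⁅G₀.e, w₁⁆ + ⁅G₀.h3, w₂⁆⁆ = 0 := by rw [hq, lie_zero]
  have hh2q : ⁅G₀.h2, ⁅G₀.e, w₁⁆ + ⁅G₀.h3, w₂⁆⁆ = 0 := by rw [hq, lie_zero]
  refine ⟨_, _, _, (modelAct_apply x 0 w₁ w₂ w₃).trans (Prod.ext_iff.2 ⟨?_, rfl⟩), ?_, ?_, ?_⟩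
  · simp [hp, hq]
  all_goals
    simp only [topAct_apply, evenAct_apply, lie_add, lie_sub, lie_smul, lie_zero,
      G₀.f_e, G₀.h2_e, G₀.h2_f, G₀.h3_e, G₀.h3_f, G₀.h2_h3] at *
  -- The `hp` and `hq` terms come from commuting the even part of `x` past `e₂`; the `hT` term is
  -- `e₂ e₃ f₂ f₃ w₃`. In the next goal the sign of `hT` changes because `e₃ e₂ = -e₂ e₃`.
  · linear_combination (norm := module) hAp + x 0 0 • hp - x 0 1 • hq + x 0 2 • hT
  · linear_combination (norm := module) hAq + x 1 1 • hq - x 1 0 • hp - x 1 2 • hT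
  -- `topAct` commutes with `G₀`. In `hep - hh2q - hq` the `w₁` terms cancel, leaving `topAct W w₂ =
  -- 0`; likewise `hfq - hh3p - hp` gives `topAct W w₁ = 0`.
  · linear_combination (norm := module) hAT + (x 0 0 + x 1 1) • hT
      + x 2 1 • (hep - hh2q - hq) - x 2 0 • (hfq - hh3p - hp)

variable {W} in
theorem modelRep_mem (u : UEnv G) {w₁ w₂ w₃ : W} (hp : ⁅G₀.h2, w₁⁆ + ⁅G₀.f, w₂⁆ = 0)
    (hq : ⁅G₀.e, w₁⁆ + ⁅G₀.h3, w₂⁆ = 0) (hT : topAct W w₃ = 0) :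
    ∃ v₁ v₂ v₃ : W, modelRep W u (0, w₁, w₂, w₃) = (0, v₁, v₂, v₃) ∧
      ⁅G₀.h2, v₁⁆ + ⁅G₀.f, v₂⁆ = 0 ∧ ⁅G₀.e, v₁⁆ + ⁅G₀.h3, v₂⁆ = 0 ∧ topAct W v₃ = 0 := by
  induction u using UEnv.induction generalizing w₁ w₂ w₃ with
  | algebraMap r =>
    refine ⟨r • w₁, r • w₂, r • w₃, by simp [Algebra.algebraMap_eq_smul_one], ?_, ?_, ?_⟩
    · rw [lie_smul, lie_smul, ← smul_add, hp, smul_zero]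
    · rw [lie_smul, lie_smul, ← smul_add, hq, smul_zero]
    · rw [map_smul, hT, smul_zero]
  | ι x =>
    rw [modelRep_ι]
    exact modelAct_mem W hp hq hT
  | mul u u' h h' =>
    obtain ⟨v₁, v₂, v₃, hv, hp', hq', hT'⟩ := h' hp hq hT
    rw [map_mul, Module.End.mul_apply, hv]
    exact h hp' hq' hT'
  | add u u' h h' =>
    obtain ⟨v₁, v₂, v₃, hv, hp₁, hq₁, hT₁⟩ := h hp hq hT
    obtain ⟨v₁', v₂', v₃', hv', hp₂, hq₂, hT₂⟩ := h' hp hq hT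
    refine ⟨v₁ + v₁', v₂ + v₂', v₃ + v₃', by simp [hv, hv'], ?_, ?_, ?_⟩
    · rw [lie_add, lie_add, add_add_add_comm, hp₁, hp₂, add_zero]
    · rw [lie_add, lie_add, add_add_add_comm, hq₁, hq₂, add_zero]
    · rw [map_add, hT₁, hT₂, add_zero]

/-- Every nonzero submodule of the induced module contains some `f₂ f₃ w` with `w ≠ 0`. -/
theorem exists_f2_f3_smul_toInduced_mem {S : Submodule (UEnv G) (Induced W)} (hS : S ≠ ⊥) :
    ∃ w : W, w ≠ 0 ∧ f2 • f3 • toInduced W w ∈ S := by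
  obtain ⟨t, ht, ht0⟩ := S.ne_bot_iff.1 hS
  obtain ⟨⟨w₀, w₁, w₂, w₃⟩, rfl⟩ : ∃ v, ofModel W v = t := ⟨_, ofModel_toModel t⟩
  rw [ofModel_apply] at ht ht0
  -- The first nonzero component is moved into `f₂ f₃ W` by a product of `f`'s that annihilates all
  -- later components.
  by_cases h₀ : w₀ = 0
  · subst h₀
    by_cases h₁ : w₁ = 0
    · subst h₁
      by_cases h₂ : w₂ = 0
      · subst h₂
        refine ⟨w₃, ?_, by simpa using ht⟩
        rintro rfl
        simp at ht0
      · exact ⟨w₂, h₂, by simpa [smul_add, f2_f2] using S.smul_mem f2 ht⟩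
    · exact ⟨w₁, h₁, by simpa [smul_add, f3_f2, f3_f3] using S.smul_mem f3 ht⟩
  · refine ⟨w₀, h₀, ?_⟩
    simpa [smul_add, f3_f2, f3_f3, f2_f2] using S.smul_mem f2 (S.smul_mem f3 ht)

theorem isAtypical_iff : IsAtypical W ↔ ∃ w : W, w ≠ 0 ∧ topAct W w = 0 := by
  constructor
  · rintro ⟨S, hS, hS'⟩
    obtain ⟨w, hw, hwS⟩ := exists_f2_f3_smul_toInduced_mem W hS
    refine ⟨w, hw, ?_⟩
    have h := S.smul_mem e2 (S.smul_mem e3 hwS)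
    rw [e2_e3_f2_f3_smul_toInduced] at h
    have h0 : toInduced W (topAct W w) ∈
        S.restrictScalars ℂ ⊓ LinearMap.range (toInduced W) := ⟨h, _, rfl⟩
    rw [hS', Submodule.mem_bot] at h0
    have := toModel_toInduced (topAct W w)
    rw [h0, map_zero] at this
    exact (Prod.ext_iff.1 this).1.symm
  · rintro ⟨w, hw, hT⟩
    have htop : toModel W (f2 • f3 • toInduced W w) = (0, 0, 0, w) := by
      rw [← toModel_ofModel (0, 0, 0, w), ofModel_apply]
      simp
    refine ⟨Submodule.span (UEnv G) {f2 • f3 • toInduced W w}, ?_, ?_⟩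
    · rw [Ne, Submodule.span_singleton_eq_bot]
      intro h
      rw [h, map_zero] at htop
      exact hw (Prod.ext_iff.1 (Prod.ext_iff.1 (Prod.ext_iff.1 htop).2).2).2.symm
    · rw [IsPermissible, Submodule.eq_bot_iff]
      rintro _ ⟨ht, w', rfl⟩
      obtain ⟨u, hu⟩ := Submodule.mem_span_singleton.1 ht
      obtain ⟨v₁, v₂, v₃, hv, -⟩ := modelRep_mem u (w₁ := (0 : W)) (w₂ := 0) (by simp) (by simp) hT
      have h := toModel_toInduced w'
      rw [← hu, toModel_smul, htop, hv] at h
      have h0 : (0 : W) = w' := (Prod.ext_iff.1 h).1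
      rw [← h0, map_zero]

end Atypical

/-! ### The Casimir operator of `sl(2)` -/

namespace sl2

def e : sl2 := ⟨G₀.e, (by simp [e₁] : e₁ 2 2 = 0)⟩
def f : sl2 := ⟨G₀.f, (by simp [f₁] : f₁ 2 2 = 0)⟩
def h : sl2 := ⟨G₀.h3 - G₀.h2, (by simp [h₁] : (h₁ + h₂ - h₂) 2 2 = 0)⟩

section Casimir

variable (M : Type*) [AddCommGroup M] [Module ℂ M] [LieRingModule sl2 M] [LieModule ℂ sl2 M]

/-- The Casimir operator `4 e f + h² - 2 h`. -/
def casimir : Module.End ℂ M where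
  toFun w := (4 : ℂ) • ⁅e, ⁅f, w⁆⁆ + ⁅h, ⁅h, w⁆⁆ - (2 : ℂ) • ⁅h, w⁆
  map_add' u v := by
    simp only [lie_add]
    module
  map_smul' t u := by
    simp only [lie_smul, RingHom.id_apply]
    module

variable {M} in
theorem casimir_apply (w : M) :
    casimir M w = (4 : ℂ) • ⁅e, ⁅f, w⁆⁆ + ⁅h, ⁅h, w⁆⁆ - (2 : ℂ) • ⁅h, w⁆ := rfl

variable {M}
variable {N : Type*} [AddCommGroup N] [Module ℂ N] [LieRingModule sl2 N] [LieModule ℂ sl2 N]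

theorem casimir_sub_pow_map (φ : M →ₗ⁅ℂ,sl2⁆ N) (t : ℂ) (k : ℕ) (w : M) :
    ((casimir N - t • 1) ^ k) (φ w) = φ (((casimir M - t • 1) ^ k) w) := by
  induction k generalizing w with
  | zero => simp
  | succ k ih =>
    rw [pow_succ, pow_succ, Module.End.mul_apply, Module.End.mul_apply, ← ih]
    congr 1
    have hs (r : ℂ) (v : M) : φ (r • v) = r • φ v := φ.toLinearMap.map_smul r v
    simp only [LinearMap.sub_apply, LinearMap.smul_apply, Module.End.one_apply, casimir_apply,
      map_sub, map_add, hs, LieModuleHom.map_lie]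

end Casimir

end sl2

/-! ### The Casimir operator on `U(a,b,m)` and its subquotients -/

/-- With `s = 2j + a + b - 2`, the part `h² - 2h` contributes `s² - 1`, while `4ef` contributes
`-4(j-1+a)(j-1+b) = (a-b)² - s²` and the shift `4 x^{(i-1)}_j`. The case `i = 0` is harmless since
`x^{(0)}_j = 0`, which allows iteration with truncated subtraction. -/
theorem UMod.casimir_sub_x (a b : ℂ) {m i : ℕ} (hi : i ≤ m) (j : ℤ) :
    (sl2.casimir (UMod a b m) - ((a - b) ^ 2 - 1) • (1 : Module.End ℂ (UMod a b m))) (x a b m i j)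
      = (4 : ℂ) • x a b m (i - 1) j := by
  have he (u : UMod a b m) : ⁅sl2.e, u⁆ = opE a b m u := by
    change rep a b m sl2.e u = _
    simp [rep, sl2.e, G₀.e, e₁]
  have hf (u : UMod a b m) : ⁅sl2.f, u⁆ = opF a b m u := by
    change rep a b m sl2.f u = _
    simp [rep, sl2.f, G₀.f, f₁]
  have hh (u : UMod a b m) : ⁅sl2.h, u⁆ = opH a b m u := by
    change rep a b m sl2.h u = _
    simp [rep, sl2.h, G₀.h2, G₀.h3, h₁, h₂]
  simp only [LinearMap.sub_apply, LinearMap.smul_apply, Module.End.one_apply, sl2.casimir_apply,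
    he, hf, hh, opE_x, opF_x, opH_x, hi, if_true, map_smul, sub_add_cancel]
  push_cast
  module

theorem UMod.casimir_sub_pow_x (a b : ℂ) {m i : ℕ} (hi : i ≤ m) (j : ℤ) (k : ℕ) :
    ((sl2.casimir (UMod a b m) - ((a - b) ^ 2 - 1) • (1 : Module.End ℂ (UMod a b m))) ^ k) (x a b m i j)
      = (4 : ℂ) ^ k • x a b m (i - k) j := by
  induction k with
  | zero => simp
  | succ k ih =>
    rw [pow_succ', Module.End.mul_apply, ih, map_smul, casimir_sub_x a b (by omega), smul_smul,
      pow_succ, Nat.sub_sub]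

theorem UMod.casimir_sub_pow (a b : ℂ) (m : ℕ) :
    (sl2.casimir (UMod a b m) - ((a - b) ^ 2 - 1) • (1 : Module.End ℂ (UMod a b m))) ^ m = 0 := by
  refine end_ext fun i j _ hi => ?_
  rw [casimir_sub_pow_x a b hi, Nat.sub_eq_zero_of_le hi, x_eq_zero (by omega), smul_zero,
    LinearMap.zero_apply]

/-- The Casimir operator commutes with module homomorphisms, so the vanishing descends along the
inclusion of `B` and then along the surjection from `B` onto `W`. -/
theorem casimir_sub_pow_eq_zero {W U : Type*} [AddCommGroup W] [Module ℂ W] [LieRingModule sl2 W]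
    [LieModule ℂ sl2 W] [AddCommGroup U] [Module ℂ U] [LieRingModule sl2 U] [LieModule ℂ sl2 U]
    (hW : IsSubquotient sl2 W U) {t : ℂ} {k : ℕ} (h : (sl2.casimir U - t • 1) ^ k = 0) :
    (sl2.casimir W - t • 1) ^ k = 0 := by
  obtain ⟨B, A, ⟨φ⟩⟩ := hW
  ext w
  obtain ⟨q, rfl⟩ := φ.surjective w
  obtain ⟨v, rfl⟩ := LieSubmodule.Quotient.surjective_mk' A q
  have hv : ((sl2.casimir B - t • 1) ^ k) v = 0 := by
    apply Subtype.val_injective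
    exact (sl2.casimir_sub_pow_map B.incl t k v).symm.trans (by rw [h]; rfl)
  have := sl2.casimir_sub_pow_map (φ.toLieModuleHom.comp (LieSubmodule.Quotient.mk' A)) t k v
  rw [hv, map_zero] at this
  exact this

/-- Since `h3 + h2` acts as `c`, `h3` can be eliminated; then `h = h3 - h2` gives `h² - c² = -4 h2
h3` and `2h - 2c = -4 h2`. -/
theorem four_smul_topAct {W : Type*} [AddCommGroup W] [Module ℂ W] [LieRingModule G₀ W]
    [LieModule ℂ G₀ W] {c : ℂ} (hc : ∀ w : W, ⁅cc, w⁆ = c • w) (w : W) :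
    (4 : ℂ) • topAct W w = sl2.casimir W w + (1 - (c + 1) ^ 2) • w := by
  have h3 (w : W) : ⁅G₀.h3, w⁆ = c • w - ⁅G₀.h2, w⁆ := by
    rw [← hc, G₀.cc_eq, add_lie, add_sub_cancel_right]
  have he (w : W) : ⁅sl2.e, w⁆ = ⁅G₀.e, w⁆ := rfl
  have hf (w : W) : ⁅sl2.f, w⁆ = ⁅G₀.f, w⁆ := rfl
  have hh (w : W) : ⁅sl2.h, w⁆ = ⁅G₀.h3, w⁆ - ⁅G₀.h2, w⁆ := sub_lie _ _ _
  simp only [sl2.casimir_apply, topAct_apply, G₀.f_e, he, hf, hh, h3, lie_sub, lie_smul]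
  module

end SL21

end

/-! ### Nilpotent plus scalar: the atypicality criterion -/

theorem lemma3p2 (a b c : ℂ) (m : ℕ)
    (W : Type*) [AddCommGroup W] [Module ℂ W]
    [LieRingModule SL21.G₀ W] [LieModule ℂ SL21.G₀ W] [Nontrivial W]
    (hW : SL21.IsSubquotient SL21.sl2 W (SL21.UMod a b m))
    (hc : ∀ w : W, ⁅SL21.cc, w⁆ = c • w) :
    SL21.IsAtypical W ↔ (a - b + c + 1 = 0 ∨ a - b - c - 1 = 0) := by
  have hnil := SL21.casimir_sub_pow_eq_zero hW (SL21.UMod.casimir_sub_pow a b m)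
  set D := SL21.sl2.casimir W - ((a - b) ^ 2 - 1) • (1 : Module.End ℂ W) with hD
  have hT (w : W) : (4 : ℂ) • SL21.topAct W w =
      D w + ((a - b + c + 1) * (a - b - c - 1)) • w := by
    rw [SL21.four_smul_topAct hc, hD]
    simp only [LinearMap.sub_apply, LinearMap.smul_apply, Module.End.one_apply]
    module
  rw [SL21.isAtypical_iff, ← mul_eq_zero]
  constructor
  · rintro ⟨w, hw, hw0⟩
    -- A kernel vector of `topAct` is an eigenvector of the nilpotent `D`, so its eigenvalue must be
    -- zero.
    have hDw : D w = (-((a - b + c + 1) * (a - b - c - 1))) • w := by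
      rw [neg_smul, ← add_eq_zero_iff_eq_neg, ← hT, hw0, smul_zero]
    have hpow (k : ℕ) : (D ^ k) w = (-((a - b + c + 1) * (a - b - c - 1))) ^ k • w := by
      induction k with
      | zero => simp
      | succ k ih => rw [pow_succ, Module.End.mul_apply, hDw, map_smul, ih, smul_smul, pow_succ']
    have := hpow m
    rw [hnil, LinearMap.zero_apply, eq_comm, smul_eq_zero] at this
    exact neg_eq_zero.1 (eq_zero_of_pow_eq_zero (this.resolve_right hw))
  · intro h0
    -- When the scalar vanishes, `topAct` is a multiple of `D`, and a nilpotent operator on a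
    -- nonzero space is not injective.
    by_contra! hne
    have hinj : Function.Injective D := by
      rw [injective_iff_map_eq_zero]
      intro w hw
      by_contra hw0
      refine hne w hw0 ?_
      have := hT w
      rw [h0, hw, zero_smul, add_zero, smul_eq_zero] at this
      exact this.resolve_left (by norm_num)
    obtain ⟨w, hw⟩ := exists_ne (0 : W)
    have hinj' : Function.Injective (D ^ m) := by
      rw [Module.End.coe_pow]
      exact hinj.iterate m
    exact hw (hinj' (by rw [hnil]; rfl))
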